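/- Let $\mathbb K\in\{\mathbb R,\mathbb C\}$, $n\ge 0$ and $\mathcal S=\mathbb K^n$. \emph{Algorithms.} An algorithm (in traditional arithmetic) is a finite acyclic computation, possibly with branching, that receives the exact inputs $x_1,\dots,x_n\in\mathbb K$ and no constants. Each step applies an operation to two (for negation, one) of the values available so far: a rounded operation $a+b$, $a-b$ or $a\cdot b$, the computed value of the $i$-th such step being $(a\circ b)(1+\delta_i)$ with its own rounding error $\delta_i\in\mathbb K$; or an exact negation $-a$. The algorithm may also branch on the outcome of an exact comparison of two available values ($a=b$ or $a<b$, where for $\mathbb K=\mathbb C$ the relation $a<b$ means that $b-a$ is a positive real number). Every path ends by outputting one of the available values; the output is denoted $p_{comp}(x,\delta)$. \emph{Accuracy.} A polynomial $p\in\mathbb K[x_1,\dots,x_n]$ is accurately evaluable on $\mathcal D\subseteq\mathcal S$ if there is an algorithm such that $p_{comp}(x,0)=p(x)$ for all $x\in\mathcal D$ and \[ \forall\,\eta\in(0,1)\ \ \exists\,\epsilon\in(0,1)\ \ \forall\,x\in\mathcal D\ \ \forall\,\delta\ \text{with all}\ |\delta_i|\le\epsilon:\qquad |p_{comp}(x,\delta)-p(x)|\le\eta\,|p(x)|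 . \] \emph{Allowability.} Let $V(p)=\{x\in\mathcal S: p(x)=0\}$. The allowable hyperplanes are the sets $\{x_i=0\}$, $\{x_i+x_j=0\}$ and $\{x_i-x_j=0\}$ with $i\ne j$. The variety $V(p)$ is called allowable if it is a union of finite intersections of allowable hyperplanes (the empty intersection being $\mathcal S$, the empty union $\emptyset$). The set $G(p)$ of points in general position consists of the points of $V(p)$ that lie in no finite intersection $W$ of allowable hyperplanes with $W\subseteq V(p)$. \textbf{Theorem.} Let $p\in\mathbb K[x_1,\dots,x_n]$. \begin{enumerate} \item Let $\mathcal D\subseteq\mathcal S$ be equal to the closure of its interior. If $\operatorname{Int}(\mathcal D)\cap G(p)\ne\emptyset$, then $p$ is not accurately evaluable on $\mathcal D$. \item In particular, if $p$ is accurately evaluable on $\mathcal S$, then $V(p)$ is allowable. \end{enumerate} -/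

import Mathlib

namespace AccurateEval

/-- The rounded binary operations. -/
inductive ArithOp where
  | add
  | sub
  | mul

/-- The exact comparisons on which an algorithm may branch. -/
inductive Comparison where
  | eq
  | lt

/-- Algorithms of the traditional model, as finite acyclic computations. A `Program m` runs in a
state in which `m` values (inputs and previously computed values) are available; an arithmetic
step appends one more value to them. The operands are indices of available values, so a value may
be used any number of times, and there are no constants. A program with branches is written as a
finite decision tree; every run follows one path, from the inputs to one output. -/
inductive Program : ℕ → Type where
  | output {m : ℕ} (a : Fin m) : Program m
  | op {m : ℕ} (o : ArithOp) (a b : Fin m) (next : Program (m + 1)) : Program m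
  | neg {m : ℕ} (a : Fin m) (next : Program (m + 1)) : Program m
  | branch {m : ℕ} (c : Comparison) (a b : Fin m) (yes no : Program m) : Program m

section

variable {𝕜 : Type*} [RCLike 𝕜]

/-- The exact result of an operation. -/
def ArithOp.eval : ArithOp → 𝕜 → 𝕜 → 𝕜
  | .add, a, b => a + b
  | .sub, a, b => a - b
  | .mul, a, b => a * b

/-- Comparisons are exact. For `𝕜 = ℝ` these are the usual `a = b` and `a < b`; for `𝕜 = ℂ`,
`lt` is the usual partial order: `b - a` is a positive real number. -/
def Comparison.Holds : Comparison → 𝕜 → 𝕜 → Prop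
  | .eq, a, b => a = b
  | .lt, a, b => RCLike.re a < RCLike.re b ∧ RCLike.im a = RCLike.im b

open Classical in
/-- `P.run v δ` is the value computed from the available values `v` with rounding errors `δ`.
The operation whose result becomes the value with index `m` has the rounding error `δ m`, so
different operations of a run have independent errors. Negation is exact. -/
noncomputable def Program.run : {m : ℕ} → Program m → (Fin m → 𝕜) → (ℕ → 𝕜) → 𝕜
  | _, .output a, v, _ => v a
  | m, .op o a b next, v, δ =>
      next.run (Fin.snoc (α := fun _ => 𝕜) v (o.eval (v a) (v b) * (1 + δ m))) δ
  | _, .neg a next, v, δ => next.run (Fin.snoc (α := fun _ => 𝕜) v (-(v a))) δ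
  | _, .branch c a b yes no, v, δ =>
      if c.Holds (v a) (v b) then yes.run v δ else no.run v δ

variable {n : ℕ}

/-- The program computes `p` exactly on `D` in the absence of rounding errors. -/
def Computes (P : Program n) (p : MvPolynomial (Fin n) 𝕜) (D : Set (Fin n → 𝕜)) : Prop :=
  ∀ x ∈ D, P.run x 0 = MvPolynomial.eval x p

/-- The program is accurate for `p` on `D`: any relative error `η` is achieved, uniformly on `D`,
with a suitable machine precision `ε`. -/
def IsAccurate (P : Program n) (p : MvPolynomial (Fin n) 𝕜) (D : Set (Fin n → 𝕜)) : Prop :=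
  ∀ η : ℝ, 0 < η → η < 1 → ∃ ε : ℝ, 0 < ε ∧ ε < 1 ∧
    ∀ x ∈ D, ∀ δ : ℕ → 𝕜, (∀ i, ‖δ i‖ ≤ ε) →
      ‖P.run x δ - MvPolynomial.eval x p‖ ≤ η * ‖MvPolynomial.eval x p‖

def AccuratelyEvaluable (p : MvPolynomial (Fin n) 𝕜) (D : Set (Fin n → 𝕜)) : Prop :=
  ∃ P : Program n, Computes P p D ∧ IsAccurate P p D

/-- The variety `V(p)`. -/
def variety (p : MvPolynomial (Fin n) 𝕜) : Set (Fin n → 𝕜) :=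
  {x | MvPolynomial.eval x p = 0}

def IsAllowableHyperplane (H : Set (Fin n → 𝕜)) : Prop :=
  (∃ i, H = {x | x i = 0}) ∨
  (∃ i j, i ≠ j ∧ H = {x | x i + x j = 0}) ∨
  (∃ i j, i ≠ j ∧ H = {x | x i - x j = 0})

/-- Finite intersections of allowable hyperplanes; the empty intersection is the whole space. -/
def IsAllowableIntersection (W : Set (Fin n → 𝕜)) : Prop :=
  ∃ ℋ : Set (Set (Fin n → 𝕜)), ℋ.Finite ∧ (∀ H ∈ ℋ, IsAllowableHyperplane H) ∧ W = ⋂₀ ℋ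

/-- Unions of intersections of allowable hyperplanes; the empty union is the empty set. -/
def IsAllowable (V : Set (Fin n → 𝕜)) : Prop :=
  ∃ 𝒲 : Set (Set (Fin n → 𝕜)), (∀ W ∈ 𝒲, IsAllowableIntersection W) ∧ V = ⋃₀ 𝒲

/-- `G(p)`, the points in general position on `V(p)`. -/
def generalPosition (p : MvPolynomial (Fin n) 𝕜) : Set (Fin n → 𝕜) :=
  variety p \ ⋃₀ {W | IsAllowableIntersection W ∧ W ⊆ variety p}

end

end AccurateEval

namespace AccurateEval

open Filter Topology

variable {𝕜 : Type*} [RCLike 𝕜]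

/-! Let `x` be a zero of `p` and `w` a point of the smallest allowable intersection containing `x`.
Join `x` to `w` by a polynomial curve whose coordinates keep every relation `x i = 0`, `x i = ± x
j`. Run the program along it with fixed rounding errors: a result that vanishes at time `0` vanishes
identically, and any other result is perturbed so that its start avoids all earlier values and their
negatives. Thus cancellation at time `0` is always identical cancellation, and branches are constant
at small positive times (`Program.exists_run_eventuallyEq`). The output is then a curve `g` with `g
0 = 0` only if `g` is identically zero. Accuracy in the limit gives `g 0 = 0`; accuracy at positive
times then makes `p` vanish along the curve, hence at `w`. So `x` is not in general position. -/

theorem eventually_ne_of_continuousAt {X Y : Type*} [TopologicalSpace X] [TopologicalSpace Y]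
    [T2Space Y] {g h : X → Y} {a : X} (hg : ContinuousAt g a) (hh : ContinuousAt h a)
    (hne : g a ≠ h a) : ∀ᶠ t in 𝓝 a, g t ≠ h t :=
  (hg.prodMk hh).preimage_mem_nhds (isClosed_diagonal.isOpen_compl.mem_nhds hne)

/-! ### Separated families of curves -/

/-- A finite set of curves, closed under negation and containing `0`, in which curves that meet at
`0` coincide, while curves that do not meet at `0` have (over the complex numbers) different
imaginary parts at all small positive times. -/
structure Separated (S : Set (ℝ → 𝕜)) : Prop where
  finite : S.Finite
  zero_mem : 0 ∈ S
  neg_mem : ∀ g ∈ S, -g ∈ S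
  continuousAt : ∀ g ∈ S, ContinuousAt g 0
  eq_of_eq : ∀ g ∈ S, ∀ h ∈ S, g 0 = h 0 → g = h
  im_ne : ∀ g ∈ S, ∀ h ∈ S, g 0 ≠ h 0 → (RCLike.I : 𝕜) = 0 ∨
    ∀ᶠ t in 𝓝[>] (0 : ℝ), RCLike.im (g t) ≠ RCLike.im (h t)

/-- A nonzero number has arbitrarily small relative perturbations that avoid a given finite set in
both coordinates. -/
theorem exists_small_perturbation_ne {e : 𝕜} (he : e ≠ 0) {T : Set 𝕜} (hT : T.Finite) {ε : ℝ}
    (hε : 0 < ε) :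
    ∃ d : 𝕜, ‖d‖ ≤ ε ∧ ∀ z ∈ T, e * (1 + d) ≠ z ∧
      ((RCLike.I : 𝕜) = 0 ∨ RCLike.im (e * (1 + d)) ≠ RCLike.im z) := by
  -- This relative error moves `e` by `s * (1 + I)`, that is, by `s` in the real part and, over the
  -- complex numbers, also in the imaginary part.
  have hcont : Tendsto (fun s : ℝ => ‖(s : 𝕜) * (1 + RCLike.I) / e‖) (𝓝[>] 0) (𝓝 0) := by
    have : Continuous (fun s : ℝ => ‖(s : 𝕜) * (1 + RCLike.I) / e‖) := by fun_prop
    simpa using (this.tendsto 0).mono_left nhdsWithin_le_nhds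
  have hsmall := hcont.eventually (gt_mem_nhds hε)
  have hbad : ∀ c : ℝ, ∀ᶠ s in 𝓝[>] (0 : ℝ), s ≠ c := by
    intro c
    rcases eq_or_ne c 0 with rfl | hc
    · filter_upwards [self_mem_nhdsWithin] with s hs using (ne_of_gt hs)
    · exact nhdsWithin_le_nhds (isOpen_ne.mem_nhds hc.symm)
  have havoid : ∀ᶠ s in 𝓝[>] (0 : ℝ), ∀ z ∈ T,
      s ≠ RCLike.re z - RCLike.re e ∧ s ≠ RCLike.im z - RCLike.im e :=
    (eventually_all_finite hT).2 fun z _ => (hbad _).and (hbad _)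
  obtain ⟨s, hs, hav⟩ := (hsmall.and havoid).exists
  refine ⟨(s : 𝕜) * (1 + RCLike.I) / e, hs.le, fun z hz => ?_⟩
  have hmul : e * (1 + (s : 𝕜) * (1 + RCLike.I) / e) = e + (s : 𝕜) * (1 + RCLike.I) := by
    field_simp
  rw [hmul]
  constructor
  · intro h
    apply (hav z hz).1
    rw [← h]
    simp
  · rcases RCLike.I_eq_zero_or_im_I_eq_one (K := 𝕜) with h0 | h1
    · exact Or.inl h0
    · refine Or.inr fun h => (hav z hz).2 ?_
      rw [← h]
      simp [h1]

/-- Closure of `S` under negation makes `-c` start away from `S` too, and `0 ∈ S` makes `c` and `-c`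
start apart. Imaginary parts that differ at `0` still differ nearby by continuity. -/
theorem Separated.insert {S : Set (ℝ → 𝕜)} (hS : Separated S) {c : ℝ → 𝕜}
    (hc : ContinuousAt c 0)
    (hne : ∀ g ∈ S, c 0 ≠ g 0 ∧ ((RCLike.I : 𝕜) = 0 ∨ RCLike.im (c 0) ≠ RCLike.im (g 0))) :
    Separated (S ∪ {c, -c}) := by
  have hz := hne 0 hS.zero_mem
  simp only [Pi.zero_apply, map_zero] at hz
  have hnz : -c 0 ≠ c 0 := fun h => hz.1 (by
    have h2 : (2 : 𝕜) * c 0 = 0 := by linear_combination -h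
    simpa using h2)
  have hneg : ∀ g ∈ S, -c 0 ≠ g 0 ∧
      ((RCLike.I : 𝕜) = 0 ∨ RCLike.im (-c 0) ≠ RCLike.im (g 0)) := by
    intro g hg
    obtain ⟨h1, h2⟩ := hne (-g) (hS.neg_mem g hg)
    refine ⟨fun h => h1 (by simp [← h]), h2.imp_right fun h2 h => h2 ?_⟩
    simp [← h]
  have hlim : ∀ {g h : ℝ → 𝕜}, ContinuousAt g 0 → ContinuousAt h 0 →
      RCLike.im (g 0) ≠ RCLike.im (h 0) →
      ∀ᶠ t in 𝓝[>] (0 : ℝ), RCLike.im (g t) ≠ RCLike.im (h t) := by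
    intro g h hg hh hgh
    exact nhdsWithin_le_nhds (eventually_ne_of_continuousAt (g := fun t => RCLike.im (g t))
      (RCLike.continuous_im.continuousAt.comp hg)
      (RCLike.continuous_im.continuousAt.comp hh) hgh)
  have hcont : ∀ g ∈ S ∪ {c, -c}, ContinuousAt g 0 := by
    rintro g (hg | rfl | rfl)
    exacts [hS.continuousAt g hg, hc, hc.neg]
  have hcc : (RCLike.I : 𝕜) = 0 ∨ RCLike.im (c 0) ≠ RCLike.im ((-c) 0) := by
    refine hz.2.imp_right fun h h' => h ?_
    simp only [Pi.neg_apply, map_neg] at h'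
    linarith
  refine ⟨hS.finite.union (by simp), Or.inl hS.zero_mem, ?_, hcont, ?_, ?_⟩
  · rintro g (hg | rfl | rfl)
    · exact Or.inl (hS.neg_mem g hg)
    · simp
    · simp
  · rintro g (hg | rfl | rfl) h (hh | rfl | rfl) hgh
    · exact hS.eq_of_eq g hg h hh hgh
    · exact ((hne g hg).1 hgh.symm).elim
    · exact ((hneg g hg).1 hgh.symm).elim
    · exact ((hne h hh).1 hgh).elim
    · rfl
    · exact (hnz hgh.symm).elim
    · exact ((hneg h hh).1 hgh).elim
    · exact (hnz hgh).elim
    · rfl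
  · intro g hg h hh hgh
    have hcg := hcont g hg
    have hch := hcont h hh
    rcases hg with hg | rfl | rfl <;> rcases hh with hh | rfl | rfl
    · exact hS.im_ne g hg h hh hgh
    · exact (hne g hg).2.imp_right fun h' => hlim hcg hch h'.symm
    · exact (hneg g hg).2.imp_right fun h' => hlim hcg hch h'.symm
    · exact (hne h hh).2.imp_right fun h' => hlim hcg hch h'
    · exact (hgh rfl).elim
    · exact hcc.imp_right fun h' => hlim hcg hch h'
    · exact (hneg h hh).2.imp_right fun h' => hlim hcg hch h'
    · exact hcc.imp_right fun h' => hlim hcg hch h'.symm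
    · exact (hgh rfl).elim

/-- An operation on separated curves whose result vanishes at `0` vanishes identically. -/
theorem Separated.op_eq_zero {S : Set (ℝ → 𝕜)} (hS : Separated S) {g h : ℝ → 𝕜} (hg : g ∈ S)
    (hh : h ∈ S) (o : ArithOp) (h0 : o.eval (g 0) (h 0) = 0) (t : ℝ) :
    o.eval (g t) (h t) = 0 := by
  cases o with
  | add =>
    have := hS.eq_of_eq g hg (-h) (hS.neg_mem h hh) (eq_neg_of_add_eq_zero_left h0)
    simp [this, ArithOp.eval]
  | sub =>
    have := hS.eq_of_eq g hg h hh (sub_eq_zero.1 h0)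
    simp [this, ArithOp.eval]
  | mul =>
    rcases mul_eq_zero.1 h0 with h0 | h0
    · have := hS.eq_of_eq g hg 0 hS.zero_mem h0
      simp [this, ArithOp.eval]
    · have := hS.eq_of_eq h hh 0 hS.zero_mem h0
      simp [this, ArithOp.eval]

/-- The outcome of a comparison of separated curves is constant at small positive times. -/
theorem Separated.eventually_holds_or {S : Set (ℝ → 𝕜)} (hS : Separated S) {g h : ℝ → 𝕜}
    (hg : g ∈ S) (hh : h ∈ S) (c : Comparison) :
    (∀ᶠ t in 𝓝[>] (0 : ℝ), c.Holds (g t) (h t)) ∨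
      ∀ᶠ t in 𝓝[>] (0 : ℝ), ¬ c.Holds (g t) (h t) := by
  have hcg := hS.continuousAt g hg
  have hch := hS.continuousAt h hh
  by_cases h0 : g 0 = h 0
  · obtain rfl := hS.eq_of_eq g hg h hh h0
    cases c with
    | eq => exact Or.inl (.of_forall fun t => rfl)
    | lt => exact Or.inr (.of_forall fun t ht => lt_irrefl _ ht.1)
  · cases c with
    | eq => exact Or.inr (nhdsWithin_le_nhds (eventually_ne_of_continuousAt hcg hch h0))
    | lt =>
      rcases hS.im_ne g hg h hh h0 with hI | him
      · have him : ∀ z : 𝕜, RCLike.im z = 0 := fun z => by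
          rw [← RCLike.im_eq_zero hI z]
        have hrg : ContinuousAt (fun t => RCLike.re (g t)) 0 :=
          RCLike.continuous_re.continuousAt.comp hcg
        have hrh : ContinuousAt (fun t => RCLike.re (h t)) 0 :=
          RCLike.continuous_re.continuousAt.comp hch
        have hre : RCLike.re (g 0) ≠ RCLike.re (h 0) := fun hr =>
          h0 (RCLike.ext hr (by rw [him, him]))
        rcases lt_or_gt_of_ne hre with hlt | hlt
        · left
          filter_upwards [nhdsWithin_le_nhds (hrg.eventually_lt hrh hlt)] with t ht
          exact ⟨ht, by rw [him, him]⟩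
        · right
          filter_upwards [nhdsWithin_le_nhds (hrh.eventually_lt hrg hlt)] with t ht h'
          exact lt_asymm ht h'.1
      · right
        filter_upwards [him] with t ht h'
        exact ht h'.2

/-! ### Choice of the rounding errors along a run -/

/-- With suitable arbitrarily small rounding errors, a program run on separated curves outputs, at
small positive times, a continuous curve that vanishes identically if it vanishes at `0`. -/
theorem Program.exists_run_eventuallyEq {ε : ℝ} (hε : 0 < ε) {m : ℕ} (P : Program m)
    (f : Fin m → ℝ → 𝕜) (S : Set (ℝ → 𝕜)) (hS : Separated S) (hf : ∀ a, f a ∈ S)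
    (δ₀ : ℕ → 𝕜) (hδ₀ : ∀ i, ‖δ₀ i‖ ≤ ε) :
    ∃ δ : ℕ → 𝕜, (∀ i, ‖δ i‖ ≤ ε) ∧ (∀ i < m, δ i = δ₀ i) ∧ ∃ g : ℝ → 𝕜, ContinuousAt g 0 ∧
      (g 0 = 0 → ∀ t, g t = 0) ∧
      ∀ᶠ t in 𝓝[>] (0 : ℝ), P.run (fun a => f a t) δ = g t := by
  induction P generalizing S δ₀ with
  | output a =>
    refine ⟨δ₀, hδ₀, fun _ _ => rfl, f a, hS.continuousAt _ (hf a), fun h0 t => ?_,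
      .of_forall fun t => rfl⟩
    rw [hS.eq_of_eq _ (hf a) 0 hS.zero_mem h0, Pi.zero_apply]
  | @op m o a b next ih =>
    obtain ⟨d, hd, S', hS', hsub, hmem⟩ : ∃ d : 𝕜, ‖d‖ ≤ ε ∧ ∃ S' : Set (ℝ → 𝕜),
        Separated S' ∧ S ⊆ S' ∧ (fun t => o.eval (f a t) (f b t) * (1 + d)) ∈ S' := by
      by_cases h0 : o.eval (f a 0) (f b 0) = 0
      · refine ⟨0, by simpa using hε.le, S, hS, subset_rfl, ?_⟩
        convert hS.zero_mem using 1
        funext t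
        simp [hS.op_eq_zero (hf a) (hf b) o h0 t]
      · obtain ⟨d, hd, hne⟩ := exists_small_perturbation_ne h0
          (hS.finite.image fun g => g 0) hε
        refine ⟨d, hd, _, hS.insert (c := fun t => o.eval (f a t) (f b t) * (1 + d)) ?_
          (fun g hg => hne _ ⟨g, hg, rfl⟩), Set.subset_union_left, by simp⟩
        have ha := hS.continuousAt _ (hf a)
        have hb := hS.continuousAt _ (hf b)
        cases o
        · exact (ha.add hb).mul continuousAt_const
        · exact (ha.sub hb).mul continuousAt_const
        · exact (ha.mul hb).mul continuousAt_const
    obtain ⟨δ, hδ, hagree, g, hg, hg0, hrun⟩ := ih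
      (Fin.snoc (α := fun _ => ℝ → 𝕜) f fun t => o.eval (f a t) (f b t) * (1 + d)) S' hS'
      (fun i => by
        refine Fin.lastCases ?_ (fun j => ?_) i
        · simpa using hmem
        · simpa using hsub (hf j))
      -- `δ₀` records the errors already chosen; the later steps may not change those of index at
      -- most `m`.
      (Function.update δ₀ m d) (fun i => by
        rcases eq_or_ne i m with rfl | hi
        · simpa using hd
        · simpa [hi] using hδ₀ i)
    refine ⟨δ, hδ, fun i hi => ?_, g, hg, hg0, ?_⟩
    · rw [hagree i (by omega), Function.update_of_ne hi.ne]
    · filter_upwards [hrun] with t ht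
      rw [← ht, Program.run, hagree m (by omega), Function.update_self]
      congr 1
      funext i
      refine Fin.lastCases ?_ (fun j => ?_) i <;> simp
  | @neg m a next ih =>
    obtain ⟨δ, hδ, hagree, g, hg, hg0, hrun⟩ := ih
      (Fin.snoc (α := fun _ => ℝ → 𝕜) f (-f a)) S hS
      (fun i => by
        refine Fin.lastCases ?_ (fun j => ?_) i
        · simpa using hS.neg_mem _ (hf a)
        · simpa using hf j) δ₀ hδ₀
    refine ⟨δ, hδ, fun i hi => hagree i (by omega), g, hg, hg0, ?_⟩
    filter_upwards [hrun] with t ht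
    rw [← ht, Program.run]
    congr 1
    funext i
    refine Fin.lastCases ?_ (fun j => ?_) i <;> simp
  | branch c a b yes no ihyes ihno =>
    rcases hS.eventually_holds_or (hf a) (hf b) c with hc | hc
    · obtain ⟨δ, hδ, hagree, g, hg, hg0, hrun⟩ := ihyes f S hS hf δ₀ hδ₀
      refine ⟨δ, hδ, hagree, g, hg, hg0, ?_⟩
      filter_upwards [hrun, hc] with t ht hct
      rw [← ht, Program.run, if_pos hct]
    · obtain ⟨δ, hδ, hagree, g, hg, hg0, hrun⟩ := ihno f S hS hf δ₀ hδ₀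
      refine ⟨δ, hδ, hagree, g, hg, hg0, ?_⟩
      filter_upwards [hrun, hc] with t ht hct
      rw [← ht, Program.run, if_neg hct]

/-! ### Curves through a zero -/

/-- The curve from `a` with velocity `I * a` and acceleration `2 * b`. -/
noncomputable def turningCurve (a b : 𝕜) (t : ℝ) : 𝕜 := (1 + RCLike.I * t) * a + t ^ 2 * b

@[simp]
theorem turningCurve_zero_right (a b : 𝕜) : turningCurve a b 0 = a := by
  simp [turningCurve]

@[fun_prop]
theorem continuous_turningCurve (a b : 𝕜) : Continuous (turningCurve a b) := by
  unfold turningCurve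
  fun_prop

/-- The velocity `I * a` turns a difference of real parts into a first-order difference of imaginary
parts, so `<` fails at small positive times over the complex numbers. -/
theorem eventually_im_turningCurve_ne {a b a' b' : 𝕜} (h : a ≠ a') :
    (RCLike.I : 𝕜) = 0 ∨ ∀ᶠ t in 𝓝[>] (0 : ℝ),
      RCLike.im (turningCurve a b t) ≠ RCLike.im (turningCurve a' b' t) := by
  rcases RCLike.I_eq_zero_or_im_I_eq_one (K := 𝕜) with hI | hI
  · exact Or.inl hI
  right
  have him : ∀ (c d : 𝕜) (t : ℝ), RCLike.im (turningCurve c d t) =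
      RCLike.im c + t * (RCLike.re c + t * RCLike.im d) := by
    intro c d t
    have h2 : ((t : 𝕜) ^ 2) = ((t ^ 2 : ℝ) : 𝕜) := by push_cast; rfl
    rw [turningCurve, h2, map_add, RCLike.im_ofReal_mul, RCLike.mul_im]
    simp [hI]
    ring
  simp only [him]
  by_cases h0 : RCLike.im a = RCLike.im a'
  · have hre : RCLike.re a ≠ RCLike.re a' := fun hr => h (RCLike.ext hr h0)
    have hev : ∀ᶠ t in 𝓝 (0 : ℝ),
        RCLike.re a + t * RCLike.im b ≠ RCLike.re a' + t * RCLike.im b' :=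
      eventually_ne_of_continuousAt (by fun_prop) (by fun_prop) (by simpa using hre)
    filter_upwards [nhdsWithin_le_nhds hev, self_mem_nhdsWithin] with t ht htpos heq
    rw [h0] at heq
    exact ht (mul_left_cancel₀ (ne_of_gt htpos) (add_left_cancel heq))
  · exact nhdsWithin_le_nhds
      (eventually_ne_of_continuousAt (by fun_prop) (by fun_prop) (by simpa using h0))

variable {n : ℕ}

theorem separated_turningCurve {x u : Fin n → 𝕜} (hz : ∀ i, x i = 0 → u i = 0)
    (hadd : ∀ i j, x i = -x j → u i = -u j) (hsub : ∀ i j, x i = x j → u i = u j) :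
    ∃ S : Set (ℝ → 𝕜), Separated S ∧ ∀ i, turningCurve (x i) (u i) ∈ S := by
  -- Pairs of start and acceleration datum, closed under negation. The hypotheses say exactly that
  -- the start determines the datum.
  let L : Set (𝕜 × 𝕜) := {0} ∪ (Set.range (fun i => (x i, u i)) ∪
    Set.range fun i => (-x i, -u i))
  have hL : ∀ q ∈ L, ∀ r ∈ L, q.1 = r.1 → q.2 = r.2 := by
    rintro _ (rfl | ⟨i, rfl⟩ | ⟨i, rfl⟩) _ (rfl | ⟨j, rfl⟩ | ⟨j, rfl⟩) h
    · rfl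
    · exact (hz j h.symm).symm
    · simp [hz j (by simpa using h.symm)]
    · exact hz i h
    · exact hsub i j h
    · exact hadd i j h
    · simp [hz i (by simpa using h)]
    · exact (hadd j i h.symm).symm
    · simp [hsub i j (by simpa using h)]
  refine ⟨(fun q : 𝕜 × 𝕜 => turningCurve q.1 q.2) '' L, ⟨?_, ?_, ?_, ?_, ?_, ?_⟩,
    fun i => ⟨(x i, u i), Or.inr (Or.inl ⟨i, rfl⟩), rfl⟩⟩
  · exact ((Set.finite_singleton _).union
      ((Set.finite_range _).union (Set.finite_range _))).image _
  · exact ⟨0, Or.inl rfl, by funext t; simp [turningCurve]⟩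
  · rintro _ ⟨q, hq, rfl⟩
    refine ⟨-q, ?_, by funext t; simp [turningCurve]; ring⟩
    rcases hq with rfl | ⟨i, rfl⟩ | ⟨i, rfl⟩
    · exact Or.inl (by simp)
    · exact Or.inr (Or.inr ⟨i, by simp⟩)
    · exact Or.inr (Or.inl ⟨i, by simp⟩)
  · rintro _ ⟨q, -, rfl⟩
    exact (continuous_turningCurve _ _).continuousAt
  · rintro _ ⟨q, hq, rfl⟩ _ ⟨r, hr, rfl⟩ h
    simp only [turningCurve_zero_right] at h
    rw [Prod.ext h (hL q hq r hr h)]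
  · rintro _ ⟨q, hq, rfl⟩ _ ⟨r, hr, rfl⟩ h
    exact eventually_im_turningCurve_ne (by simpa using h)

/-- A polynomial that vanishes at small positive times on a turning curve vanishes on all of it. -/
theorem eval_turningCurve_eq_zero (p : MvPolynomial (Fin n) 𝕜) (x u : Fin n → 𝕜)
    (h : ∀ᶠ t in 𝓝[>] (0 : ℝ),
      MvPolynomial.eval (fun i => turningCurve (x i) (u i) t) p = 0) (t : ℝ) :
    MvPolynomial.eval (fun i => turningCurve (x i) (u i) t) p = 0 := by
  let q : Polynomial 𝕜 := MvPolynomial.aeval (fun i =>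
    (1 + .C RCLike.I * .X) * .C (x i) + .X ^ 2 * .C (u i) : Fin n → Polynomial 𝕜) p
  have hq : ∀ t : ℝ, q.eval (t : 𝕜) =
      MvPolynomial.eval (fun i => turningCurve (x i) (u i) t) p := by
    intro t
    change Polynomial.evalRingHom (t : 𝕜) (MvPolynomial.aeval _ p) = _
    rw [MvPolynomial.map_aeval, MvPolynomial.eval, MvPolynomial.coe_eval₂Hom,
      MvPolynomial.coe_eval₂Hom]
    congr 1
    · ext; simp
    · funext i; simp [turningCurve, mul_comm (u i)]
  have hinf : {t : ℝ | q.eval (t : 𝕜) = 0}.Infinite := by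
    obtain ⟨b, hb, hsub⟩ := mem_nhdsGT_iff_exists_Ioo_subset.1 h
    exact (Set.Ioo_infinite hb).mono fun s hs => (hq s).trans (hsub hs)
  have hq0 : q = 0 := Polynomial.eq_zero_of_infinite_isRoot q
    ((hinf.image RCLike.ofReal_injective.injOn).mono (by rintro _ ⟨s, hs, rfl⟩; exact hs))
  rw [← hq, hq0, Polynomial.eval_zero]

/-! ### The allowable hull and the conclusion -/

/-- The smallest intersection of allowable hyperplanes that contains a given point. -/
def allowableHull (x : Fin n → 𝕜) : Set (Fin n → 𝕜) :=
  ⋂₀ {H | IsAllowableHyperplane H ∧ x ∈ H}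

theorem isAllowableIntersection_allowableHull (x : Fin n → 𝕜) :
    IsAllowableIntersection (allowableHull x) := by
  refine ⟨_, Set.Finite.subset (s := Set.range (fun i => {x : Fin n → 𝕜 | x i = 0}) ∪
    (Set.range (fun q : Fin n × Fin n => {x : Fin n → 𝕜 | x q.1 + x q.2 = 0}) ∪
      Set.range (fun q : Fin n × Fin n => {x : Fin n → 𝕜 | x q.1 - x q.2 = 0})))
    ((Set.finite_range _).union ((Set.finite_range _).union (Set.finite_range _))) ?_,
    fun H hH => hH.1, rfl⟩
  rintro H ⟨⟨i, rfl⟩ | ⟨i, j, -, rfl⟩ | ⟨i, j, -, rfl⟩, -⟩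
  · exact Or.inl ⟨i, rfl⟩
  · exact Or.inr (Or.inl ⟨(i, j), rfl⟩)
  · exact Or.inr (Or.inr ⟨(i, j), rfl⟩)

theorem mem_allowableHull (x : Fin n → 𝕜) : x ∈ allowableHull x := fun _ hH => hH.2

theorem separated_of_mem_allowableHull {x u : Fin n → 𝕜} (hu : u ∈ allowableHull x) :
    ∃ S : Set (ℝ → 𝕜), Separated S ∧ ∀ i, turningCurve (x i) (u i) ∈ S := by
  have hz : ∀ i, x i = 0 → u i = 0 := fun i hi => hu _ ⟨Or.inl ⟨i, rfl⟩, hi⟩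
  refine separated_turningCurve hz (fun i j hij => ?_) (fun i j hij => ?_)
  -- Allowable hyperplanes need distinct indices; for `i = j` the relation says `x i = 0`.
  · rcases eq_or_ne i j with rfl | hne
    · have := hz i (self_eq_neg.1 hij)
      simp [this]
    · exact eq_neg_of_add_eq_zero_left
        (hu _ ⟨Or.inr (Or.inl ⟨i, j, hne, rfl⟩), by simp [hij]⟩)
  · rcases eq_or_ne i j with rfl | hne
    · rfl
    · exact sub_eq_zero.1 (hu _ ⟨Or.inr (Or.inr ⟨i, j, hne, rfl⟩), sub_eq_zero.2 hij⟩)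

theorem turningCurve_one_eq (a w : 𝕜) :
    turningCurve a (w - (1 + RCLike.I) * a) 1 = w := by
  simp [turningCurve]

/-- The hull is a linear subspace containing `x`. -/
theorem sub_smul_mem_allowableHull {x w : Fin n → 𝕜} (hw : w ∈ allowableHull x) (c : 𝕜) :
    w - c • x ∈ allowableHull x := by
  intro H hH
  have h1 := hw H hH
  obtain ⟨hH, hx⟩ := hH
  rcases hH with ⟨i, rfl⟩ | ⟨i, j, -, rfl⟩ | ⟨i, j, -, rfl⟩ <;>
    simp only [Set.mem_ofPred_eq, Pi.sub_apply, Pi.smul_apply, smul_eq_mul] at h1 hx ⊢ <;>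
    linear_combination h1 - c * hx

/-- If a program is accurate for `p` near a zero `x` of `p`, then `p` vanishes on the smallest
intersection of allowable hyperplanes that contains `x`. -/
theorem IsAccurate.allowableHull_subset {P : Program n} {p : MvPolynomial (Fin n) 𝕜}
    {D : Set (Fin n → 𝕜)} (hP : IsAccurate P p D) {x : Fin n → 𝕜} (hxD : D ∈ 𝓝 x)
    (hx : x ∈ variety p) : allowableHull x ⊆ variety p := by
  intro w hw
  -- This makes the curve reach `w` at time `1`.
  set u := w - (1 + RCLike.I : 𝕜) • x with hu
  obtain ⟨S, hS, hmem⟩ := separated_of_mem_allowableHull (sub_smul_mem_allowableHull hw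
    (1 + RCLike.I))
  obtain ⟨ε, hε, -, hacc⟩ := hP (1 / 2) (by norm_num) (by norm_num)
  obtain ⟨δ, hδ, -, g, hg, hg0, hrun⟩ := P.exists_run_eventuallyEq hε _ S hS hmem 0
    (fun i => by simpa using hε.le)
  let γ : ℝ → Fin n → 𝕜 := fun t i => turningCurve (x i) (u i) t
  have hγ : Continuous γ := continuous_pi fun i => continuous_turningCurve _ _
  have hγ0 : γ 0 = x := by funext i; simp [γ]
  have hpγ : Continuous fun t => MvPolynomial.eval (γ t) p :=
    (MvPolynomial.continuous_eval p).comp hγ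
  have hD : ∀ᶠ t in 𝓝[>] (0 : ℝ), γ t ∈ D :=
    nhdsWithin_le_nhds (hγ.continuousAt.preimage_mem_nhds (by rwa [hγ0]))
  have hle : ∀ᶠ t in 𝓝[>] (0 : ℝ), ‖g t - MvPolynomial.eval (γ t) p‖ ≤
      1 / 2 * ‖MvPolynomial.eval (γ t) p‖ := by
    filter_upwards [hD, hrun] with t ht hrt
    rw [← hrt]
    exact hacc _ ht δ hδ
  -- The run at time `0` itself may take another branch, so the bound there comes from a limit.
  have hlim : ‖g 0 - MvPolynomial.eval (γ 0) p‖ ≤ 1 / 2 * ‖MvPolynomial.eval (γ 0) p‖ :=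
    le_of_tendsto_of_tendsto
      ((hg.sub hpγ.continuousAt).norm.tendsto.mono_left nhdsWithin_le_nhds)
      ((hpγ.norm.const_mul (1 / 2)).continuousAt.tendsto.mono_left nhdsWithin_le_nhds) hle
  have hg00 : g 0 = 0 := by
    have hx' : MvPolynomial.eval x p = 0 := hx
    simpa [hγ0, hx'] using hlim
  have hzero : ∀ᶠ t in 𝓝[>] (0 : ℝ), MvPolynomial.eval (γ t) p = 0 := by
    filter_upwards [hle] with t ht
    rw [hg0 hg00 t, zero_sub, norm_neg] at ht
    exact norm_le_zero_iff.1 (by linarith)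
  have h1 := eval_turningCurve_eq_zero p x u hzero 1
  have hw1 : (fun i => turningCurve (x i) (u i) 1) = w := by
    funext i
    exact turningCurve_one_eq (x i) (w i)
  rwa [hw1] at h1

theorem not_accuratelyEvaluable {p : MvPolynomial (Fin n) 𝕜} {D : Set (Fin n → 𝕜)}
    (h : (interior D ∩ generalPosition p).Nonempty) : ¬ AccuratelyEvaluable p D := by
  rintro ⟨P, -, hP⟩
  obtain ⟨x, hxD, hxV, hxW⟩ := h
  exact hxW ⟨allowableHull x, ⟨isAllowableIntersection_allowableHull x,
    hP.allowableHull_subset (mem_interior_iff_mem_nhds.1 hxD) hxV⟩, mem_allowableHull x⟩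

end AccurateEval

theorem mainTheorem1 {𝕜 : Type*} [RCLike 𝕜] {n : ℕ} (p : MvPolynomial (Fin n) 𝕜) :
    (∀ D : Set (Fin n → 𝕜), D = closure (interior D) →
      (interior D ∩ AccurateEval.generalPosition p).Nonempty →
        ¬ AccurateEval.AccuratelyEvaluable p D) ∧
    (AccurateEval.AccuratelyEvaluable p Set.univ →
      AccurateEval.IsAllowable (AccurateEval.variety p)) := by
  refine ⟨fun D _ h => AccurateEval.not_accuratelyEvaluable h, fun h => ?_⟩
  refine ⟨{W | AccurateEval.IsAllowableIntersection W ∧ W ⊆ AccurateEval.variety p},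
    fun W hW => hW.1, Set.Subset.antisymm (fun x hx => ?_)
      (Set.sUnion_subset fun W hW => hW.2)⟩
  -- A zero outside all these intersections is in general position, and the whole space is its own
  -- interior.
  by_contra hxW
  exact AccurateEval.not_accuratelyEvaluable ⟨x, by simp, hx, hxW⟩ h
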